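/- Fix an integer $k \ge 2$. Let $Z$ be a random variable with values in $\{1,2,3,\dots\}$, let $Z^{(1)},\dots,Z^{(k)}$ be independent copies of $Z$, and let $(Z_n^{(i)})_{n\ge 1,\,1\le i\le k}$ be independent random variables, each distributed as $Z$. In the $k$-choice model, the set $T_n\subset\mathbb{Z}$ of vertices reached from $n\in\mathbb{Z}$ is defined recursively by $T_n=\{n\}$ for $n\le 0$ and $$T_n=\{n\}\cup\bigcup_{i=1}^k T_{n-Z_n^{(i)}}\qquad (n\ge 1),$$ and $\Lambda_n=|T_n\cap\{0,-1,-2,\dots\}|$ is the number of leaves reached from $n$. Assume that the law of $Z$ is aperiodic, that is, the greatest common divisor of the support of $Z$ is $1$, and that $$\mathbb{E}[Z]=\infty,\qquad \mathbb{E}\Big[\min_{1\le i\le k}Z^{(i)}\Big]<\infty .$$ Then $\Lambda_n\to\infty$ almost surely as $n\to\infty$. -/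

import Mathlib

open MeasureTheory ProbabilityTheory Filter
open scoped ENNReal

/-- The positive integers carry the discrete σ-algebra. -/
instance instMeasurableSpacePNat : MeasurableSpace ℕ+ := ⊤

instance instDiscreteMeasurableSpacePNat : DiscreteMeasurableSpace ℕ+ :=
  ⟨fun _ => trivial⟩

namespace KChoice

variable {k : ℕ}

/-- The finite set `T_n` of vertices reached from the vertex `n : ℤ` in the `k`-choice graph with
delays `z m i` (`m ≥ 1`, `i : Fin k`): `T_n = {n}` for `n ≤ 0`, and
`T_n = {n} ∪ ⋃ i, T_{n - z n i}` for `n ≥ 1`. -/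
def T (z : ℕ+ → Fin k → ℕ+) (n : ℤ) : Finset ℤ :=
  if h : 0 < n then
    {n} ∪ Finset.univ.biUnion
      fun i : Fin k => T z (n - ((z ⟨n.toNat, by omega⟩ i : ℕ) : ℤ))
  else {n}
termination_by n.toNat
decreasing_by
  have := (z ⟨n.toNat, by omega⟩ i).pos
  omega

theorem T_of_nonpos (z : ℕ+ → Fin k → ℕ+) {n : ℤ} (hn : n ≤ 0) : T z n = {n} := by
  rw [T, dif_neg (not_lt.mpr hn)]

theorem T_of_pos (z : ℕ+ → Fin k → ℕ+) (n : ℕ+) :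
    T z ((n : ℕ) : ℤ) =
      {((n : ℕ) : ℤ)} ∪ Finset.univ.biUnion
        fun i : Fin k => T z (((n : ℕ) : ℤ) - ((z n i : ℕ) : ℤ)) := by
  have hn : (0 : ℤ) < ((n : ℕ) : ℤ) := by exact_mod_cast n.pos
  rw [T, dif_pos hn]
  rfl

/-- The set `𝓛_n = T_n ∩ {0, -1, -2, …}` of leaves reached from `n`. -/
def leaves (z : ℕ+ → Fin k → ℕ+) (n : ℤ) : Finset ℤ :=
  (T z n).filter fun m => m ≤ 0

/-- The number `Λ_n = |𝓛_n|` of leaves reached from `n`. -/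
def numLeaves (z : ℕ+ → Fin k → ℕ+) (n : ℤ) : ℕ :=
  (leaves z n).card

/-- The support of the law of a positive-integer valued random variable `Z`. -/
def lawSupport {Ω : Type*} [MeasurableSpace Ω] (P : Measure Ω) (Z : Ω → ℕ+) : Set ℕ :=
  {m | 0 < P {ω | (Z ω : ℕ) = m}}

/-- The law of `Z` is aperiodic: the greatest common divisor of its support is `1`. -/
def Aperiodic {Ω : Type*} [MeasurableSpace Ω] (P : Measure Ω) (Z : Ω → ℕ+) : Prop :=
  Nat.setGcd (lawSupport P Z) = 1

end KChoice

/-!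
The idea is to find vertices `v` that are reached from all large vertices and that have one very
long delay.

Let `S` be the additive monoid generated by the support of `Z`; by aperiodicity it contains all
large integers. Call `v` a regeneration vertex if, from each vertex `v + j` with `0 < j ∈ S`, one of
the delays leads to some `v + r` with `r ∈ S`. Going down, such a path ends at `v`, so `T v ⊆ T n`
for all large `n` (`KChoice.IsRegeneration.T_subset`). The condition concerns only the delays above
`v`, and since the minimum of `k` delays has finite mean, its probability is bounded below
uniformly in `v` (`KChoice.exists_pos_le_measure_isRegeneration`).

Fix `K`. The event that the first delay at `v` is at least `v + K` is independent of regeneration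
at `v`, and its probabilities have infinite sum over `v` because `Z` has infinite mean. A
second-moment bound for unions (`sq_div_two_le_measureReal_biUnion`) and Kolmogorov's 0-1 law then
show that almost surely some (indeed infinitely many) `v` are regeneration vertices with such a long
delay (`KChoice.ae_exists_mem_inter`, `KChoice.ae_exists_isRegeneration_and_le`). The long delay ends
at a leaf at or below `-K`, which belongs to `T n` for all large `n`. As `K` is arbitrary, there are
infinitely many leaves each of which is reached from all large vertices, which gives the claim
(`KChoice.tendsto_numLeaves`).
-/

/-! ### A second-moment lower bound for unions -/

/-- A Kochen–Stone type inequality: if the events `E i` have probabilities between `c * p i` and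
`p i`, with pair correlations at most `p i * p j`, and the `p i` sum to at least `1`, then the
union has probability at least `c ^ 2 / 2`. -/
theorem sq_div_two_le_measureReal_biUnion {Ω ι : Type*} [MeasurableSpace Ω] {P : Measure Ω}
    [IsProbabilityMeasure P] {E : ι → Set Ω} (hE : ∀ i, MeasurableSet (E i)) {p : ι → ℝ} {c : ℝ}
    (hc : 0 ≤ c) (F : Finset ι) (hlow : ∀ i, c * p i ≤ P.real (E i))
    (hup : ∀ i, P.real (E i) ≤ p i)
    (hpair : ∀ i j, i ≠ j → P.real (E i ∩ E j) ≤ p i * p j) (hsum : 1 ≤ ∑ i ∈ F, p i) :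
    c ^ 2 / 2 ≤ P.real (⋃ i ∈ F, E i) := by
  classical
  set S := ∑ i ∈ F, p i with hS
  have hp : ∀ i, 0 ≤ p i := fun i => measureReal_nonneg.trans (hup i)
  -- This value of `t` maximises the lower bound `2 * t * (c * S) - t ^ 2 * (S + S * S)`.
  set t := c / (1 + S) with ht
  have ht0 : 0 ≤ t := by positivity
  let I : ι → Ω → ℝ := fun i => (E i).indicator 1
  have hII : ∀ i j ω, I i ω * I j ω = (E i ∩ E j).indicator (1 : Ω → ℝ) ω := by
    intro i j ω
    simp [I, Set.inter_indicator_one]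
  -- With `N` the number of events that occur, `2 * t * N - t ^ 2 * N ^ 2 = 1 - (1 - t * N) ^ 2` is
  -- at most `1`, and vanishes where `N = 0`.
  have hpt : ∀ ω, 2 * t * ∑ i ∈ F, I i ω
        - t ^ 2 * ∑ i ∈ F, ∑ j ∈ F, (E i ∩ E j).indicator (1 : Ω → ℝ) ω
      ≤ (⋃ i ∈ F, E i).indicator (1 : Ω → ℝ) ω := by
    intro ω
    have hsq : ∑ i ∈ F, ∑ j ∈ F, (E i ∩ E j).indicator (1 : Ω → ℝ) ω = (∑ i ∈ F, I i ω) ^ 2 := by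
      rw [sq, Finset.sum_mul_sum]
      simp only [hII]
    rw [hsq]
    by_cases hω : ω ∈ ⋃ i ∈ F, E i
    · rw [Set.indicator_of_mem hω, Pi.one_apply]
      nlinarith [sq_nonneg (1 - t * ∑ i ∈ F, I i ω)]
    · have : ∑ i ∈ F, I i ω = 0 := by
        refine Finset.sum_eq_zero fun i hi => Set.indicator_of_notMem (fun h => hω ?_) _
        exact Set.mem_biUnion hi h
      rw [Set.indicator_of_notMem hω, this]
      simp
  have hint : ∀ A : Set Ω, MeasurableSet A → Integrable (A.indicator (1 : Ω → ℝ)) P :=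
    fun A hA => (integrable_const (1 : ℝ)).indicator hA
  have hU : MeasurableSet (⋃ i ∈ F, E i) := F.measurableSet_biUnion fun i _ => hE i
  have hi1 : Integrable (fun ω => 2 * t * ∑ i ∈ F, I i ω) P :=
    (integrable_finsetSum _ fun i _ => hint _ (hE i)).const_mul _
  have hi2 : Integrable
      (fun ω => t ^ 2 * ∑ i ∈ F, ∑ j ∈ F, (E i ∩ E j).indicator (1 : Ω → ℝ) ω) P :=
    (integrable_finsetSum _ fun i _ => integrable_finsetSum _ fun j _ =>
      hint _ ((hE i).inter (hE j))).const_mul _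
  have key := integral_mono (hi1.sub hi2) (hint _ hU) hpt
  simp only [Pi.sub_apply] at key
  rw [integral_sub hi1 hi2, integral_const_mul, integral_const_mul,
    integral_finsetSum _ fun i _ => hint _ (hE i),
    integral_finsetSum _ fun i _ => integrable_finsetSum _ fun j _ =>
      hint _ ((hE i).inter (hE j)), integral_indicator_one hU] at key
  have hdbl : ∑ i ∈ F, ∫ ω, ∑ j ∈ F, (E i ∩ E j).indicator (1 : Ω → ℝ) ω ∂P ≤ S + S * S := by
    calc _ = ∑ i ∈ F, ∑ j ∈ F, P.real (E i ∩ E j) := by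
          refine Finset.sum_congr rfl fun i _ => ?_
          rw [integral_finsetSum _ fun j _ => hint _ ((hE i).inter (hE j))]
          exact Finset.sum_congr rfl fun j _ => integral_indicator_one ((hE i).inter (hE j))
      _ ≤ ∑ i ∈ F, ∑ j ∈ F, ((if i = j then p i else 0) + p i * p j) := by
          refine Finset.sum_le_sum fun i _ => Finset.sum_le_sum fun j _ => ?_
          by_cases hij : i = j
          · subst hij
            simp only [Set.inter_self, if_true]
            nlinarith [hup i, hp i]
          · simpa [hij] using hpair i j hij
      _ = S + S * S := by
          simp only [Finset.sum_add_distrib, hS, Finset.sum_mul_sum]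
          congr 1
          exact Finset.sum_congr rfl fun i hi => by simp [hi]
  have hsing : c * S ≤ ∑ i ∈ F, ∫ ω, I i ω ∂P := by
    rw [hS, Finset.mul_sum]
    refine Finset.sum_le_sum fun i _ => ?_
    rw [integral_indicator_one (hE i)]
    exact hlow i
  have h1 : 2 * t * (c * S) - t ^ 2 * (S + S * S) ≤ P.real (⋃ i ∈ F, E i) :=
    le_trans (by gcongr) key
  have h2 : 2 * t * (c * S) - t ^ 2 * (S + S * S) = c ^ 2 * (S / (1 + S)) := by
    rw [ht]; field_simp; ring
  have h3 : 1 / 2 ≤ S / (1 + S) := by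
    rw [div_le_div_iff₀ (by norm_num) (by linarith)]; linarith
  calc c ^ 2 / 2 = c ^ 2 * (1 / 2) := by ring
    _ ≤ c ^ 2 * (S / (1 + S)) := by gcongr
    _ ≤ _ := h2 ▸ h1

/-! ### Layer-cake formulas -/

theorem natCast_eq_tsum_indicator {Ω : Type*} (Z : Ω → ℕ+) (ω : Ω) :
    ((Z ω : ℕ) : ℝ≥0∞) = ∑' t : ℕ, {ω | t < (Z ω : ℕ)}.indicator (1 : Ω → ℝ≥0∞) ω := by
  rw [tsum_eq_sum (s := Finset.range (Z ω))]
  · rw [Finset.sum_congr rfl fun t ht => Set.indicator_of_mem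
      (show ω ∈ {ω | t < (Z ω : ℕ)} from Finset.mem_range.1 ht) _]
    simp
  · intro t ht
    have hω : ω ∉ {ω | t < (Z ω : ℕ)} := fun h : t < (Z ω : ℕ) => ht (Finset.mem_range.2 h)
    exact Set.indicator_of_notMem hω _

theorem lintegral_pnat_eq_tsum {Ω : Type*} [MeasurableSpace Ω] {P : Measure Ω} {Z : Ω → ℕ+}
    (hZ : AEMeasurable Z P) :
    ∫⁻ ω, ((Z ω : ℕ) : ℝ≥0∞) ∂P = ∑' t : ℕ, P {ω | t < (Z ω : ℕ)} := by
  have hm : ∀ t : ℕ, NullMeasurableSet {ω | t < (Z ω : ℕ)} P := fun t =>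
    hZ.nullMeasurable (MeasurableSet.of_discrete (s := {m : ℕ+ | t < (m : ℕ)}))
  calc _ = ∫⁻ ω, ∑' t : ℕ, {ω | t < (Z ω : ℕ)}.indicator (1 : Ω → ℝ≥0∞) ω ∂P :=
        lintegral_congr fun ω => natCast_eq_tsum_indicator Z ω
    _ = ∑' t : ℕ, ∫⁻ ω, {ω | t < (Z ω : ℕ)}.indicator (1 : Ω → ℝ≥0∞) ω ∂P :=
        lintegral_tsum fun t => aemeasurable_one.indicator₀ (hm t)
    _ = _ := tsum_congr fun t => lintegral_indicator_one₀ (hm t)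

/-- The layer-cake formula for a minimum. Only the inequality needed to make the tail
probabilities summable is stated; it also holds for an empty index set, where the infimum is
`∞`. -/
theorem tsum_measure_lt_le_lintegral_iInf {Ω ι : Type*} [MeasurableSpace Ω] [Countable ι]
    {P : Measure Ω} {Z : ι → Ω → ℕ+} (hZ : ∀ i, AEMeasurable (Z i) P) :
    ∑' t : ℕ, P {ω | ∀ i, t < (Z i ω : ℕ)} ≤ ∫⁻ ω, ⨅ i, ((Z i ω : ℕ) : ℝ≥0∞) ∂P := by
  have hm : ∀ t : ℕ, NullMeasurableSet {ω | ∀ i, t < (Z i ω : ℕ)} P := fun t => by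
    rw [Set.ofPred_forall]
    exact NullMeasurableSet.iInter fun i =>
      (hZ i).nullMeasurable (MeasurableSet.of_discrete (s := {m : ℕ+ | t < (m : ℕ)}))
  calc _ = ∑' t : ℕ, ∫⁻ ω, {ω | ∀ i, t < (Z i ω : ℕ)}.indicator (1 : Ω → ℝ≥0∞) ω ∂P :=
        tsum_congr fun t => (lintegral_indicator_one₀ (hm t)).symm
    _ = ∫⁻ ω, ∑' t : ℕ, {ω | ∀ i, t < (Z i ω : ℕ)}.indicator (1 : Ω → ℝ≥0∞) ω ∂P :=
        (lintegral_tsum fun t => aemeasurable_one.indicator₀ (hm t)).symm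
    _ ≤ _ := lintegral_mono fun ω => le_iInf fun i => by
        rw [natCast_eq_tsum_indicator (Z i) ω]
        exact ENNReal.tsum_le_tsum fun t =>
          Set.indicator_le_indicator_of_subset (fun ω (h : ∀ i, t < (Z i ω : ℕ)) => h i)
            (fun _ => zero_le_one) ω

/-! ### Regeneration vertices and leaves -/

namespace KChoice

/-- The vertex `v` is a regeneration vertex, relative to a set `S` of distances, if every vertex
at a positive distance `j ∈ S` above `v` has a delay that leads to a vertex at a distance `r ∈ S`
above `v` (possibly `r = 0`, that is, `v` itself). If `S` contains all large integers, then `v` is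
reached from all large vertices. -/
def IsRegeneration {k : ℕ} (S : Set ℕ) (z : ℕ+ → Fin k → ℕ+) (v : ℕ+) : Prop :=
  ∀ j : ℕ+, (j : ℕ) ∈ S → ∃ i, ∃ r ∈ S, (j : ℕ) = r + z (v + j) i

/-- Descending from `v + j` along the delays provided by regeneration keeps the distance to `v` in
`S`, so the descent can only stop at `v`. -/
theorem IsRegeneration.T_subset {k : ℕ} {S : Set ℕ} {z : ℕ+ → Fin k → ℕ+} {v : ℕ+}
    (h : IsRegeneration S z v) (j : ℕ) (hj : j ∈ S) :
    T z ((v : ℕ) : ℤ) ⊆ T z (((v : ℕ) : ℤ) + j) := by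
  induction j using Nat.strong_induction_on with
  | _ j ih =>
    rcases Nat.eq_zero_or_pos j with rfl | hpos
    · simp
    · obtain ⟨i, r, hr, hjr⟩ := h ⟨j, hpos⟩ hj
      have hz := (z (v + ⟨j, hpos⟩) i).pos
      have hjr : j = r + z (v + ⟨j, hpos⟩) i := hjr
      have hT := T_of_pos z (v + ⟨j, hpos⟩)
      have hcast : (((v + ⟨j, hpos⟩ : ℕ+) : ℕ) : ℤ) = ((v : ℕ) : ℤ) + j := rfl
      rw [hcast] at hT
      rw [hT]
      refine (ih r (by omega) hr).trans (Finset.Subset.trans ?_ Finset.subset_union_right)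
      have : ((v : ℕ) : ℤ) + r = (v : ℕ) + (j : ℤ) - ((z (v + ⟨j, hpos⟩) i : ℕ) : ℤ) := by omega
      rw [this]
      exact Finset.subset_biUnion_of_mem
        (fun i => T z (((v : ℕ) : ℤ) + (j : ℤ) - ((z (v + ⟨j, hpos⟩) i : ℕ) : ℤ)))
        (Finset.mem_univ i)

theorem sub_mem_T {k : ℕ} (z : ℕ+ → Fin k → ℕ+) (v : ℕ+) (i : Fin k)
    (h : (v : ℕ) ≤ z v i) : ((v : ℕ) : ℤ) - ((z v i : ℕ) : ℤ) ∈ T z ((v : ℕ) : ℤ) := by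
  rw [T_of_pos]
  refine Finset.mem_union_right _ (Finset.mem_biUnion.2 ⟨i, Finset.mem_univ i, ?_⟩)
  rw [T_of_nonpos z (by omega)]
  simp

/-- If there are regeneration vertices from which a single delay leads arbitrarily far below `0`,
then the set of leaves reached from all large vertices is unbounded below, hence infinite. -/
theorem tendsto_numLeaves {k : ℕ} (z : ℕ+ → Fin k → ℕ+)
    {S : Set ℕ} {N : ℕ} (hS : ∀ m ≥ N, m ∈ S)
    (h : ∀ K : ℕ, ∃ v, IsRegeneration S z v ∧ ∃ i, (v : ℕ) + K ≤ z v i) :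
    Tendsto (fun n : ℕ => numLeaves z (n : ℤ)) atTop atTop := by
  let B : Set ℤ := {l | ∀ᶠ n : ℕ in atTop, l ∈ leaves z n}
  have hB : ∀ K : ℕ, ∃ l ∈ B, l ≤ -(K : ℤ) := by
    intro K
    obtain ⟨v, hv, i, hi⟩ := h K
    refine ⟨((v : ℕ) : ℤ) - ((z v i : ℕ) : ℤ), ?_, by omega⟩
    filter_upwards [eventually_ge_atTop ((v : ℕ) + N)] with n hn
    obtain ⟨j, rfl⟩ := Nat.exists_eq_add_of_le (show (v : ℕ) ≤ n by omega)
    refine Finset.mem_filter.2 ⟨?_, by omega⟩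
    push_cast
    exact hv.T_subset j (hS j (by omega)) (sub_mem_T z v i (by omega))
  have hinf : B.Infinite := by
    intro hfin
    obtain ⟨b, hb⟩ := hfin.bddBelow
    obtain ⟨l, hl, hle⟩ := hB (b.natAbs + 1)
    have := hb hl
    omega
  refine tendsto_atTop.2 fun M => ?_
  obtain ⟨F, hFB, rfl⟩ := hinf.exists_subset_card_eq M
  filter_upwards [(F.eventually_all).2 fun l hl => hFB hl] with n hn
  exact Finset.card_le_card hn

/-! ### Delays at a set of vertices -/

section Delays

variable {Ω : Type*} {k : ℕ} {X : ℕ+ → Fin k → Ω → ℕ+}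

/-- The σ-algebra on `Ω` generated by the delays `X n i` at the vertices `n ∈ W`. It is indexed by
the pairs `(n, i)`, so that independence of the family of all delays applies directly. -/
abbrev delaySigma (X : ℕ+ → Fin k → Ω → ℕ+) (W : Set ℕ+) : MeasurableSpace Ω :=
  ⨆ p ∈ (Prod.fst ⁻¹' W : Set (ℕ+ × Fin k)), MeasurableSpace.comap (X p.1 p.2) inferInstance

theorem delaySigma_mono {W W' : Set ℕ+} (h : W ⊆ W') : delaySigma X W ≤ delaySigma X W' :=
  biSup_mono fun _ hp => h hp

theorem measurableSet_delaySigma {W : Set ℕ+} {n : ℕ+} (hn : n ∈ W) (i : Fin k)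
    (p : ℕ+ → Prop) : MeasurableSet[delaySigma X W] {ω | p (X n i ω)} := by
  have hle : MeasurableSpace.comap (X n i) inferInstance ≤ delaySigma X W :=
    le_iSup₂_of_le (f := fun (p : ℕ+ × Fin k) (_ : p ∈ (Prod.fst ⁻¹' W : Set (ℕ+ × Fin k))) =>
      MeasurableSpace.comap (X p.1 p.2) inferInstance) (n, i) hn le_rfl
  exact hle _ ⟨{m | p m}, MeasurableSet.of_discrete, rfl⟩

variable [mΩ : MeasurableSpace Ω] {P : Measure Ω}

theorem delaySigma_le (hX : ∀ n i, Measurable (X n i)) (W : Set ℕ+) : delaySigma X W ≤ mΩ :=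
  iSup₂_le fun p _ => (hX p.1 p.2).comap_le

theorem indep_delaySigma (hX : ∀ n i, Measurable (X n i))
    (hind : iIndepFun (fun p : ℕ+ × Fin k => X p.1 p.2) P) {W W' : Set ℕ+} (h : Disjoint W W') :
    Indep (delaySigma X W) (delaySigma X W') P :=
  indep_iSup_of_disjoint
    (m := fun p : ℕ+ × Fin k => MeasurableSpace.comap (X p.1 p.2) inferInstance)
    (fun p => (hX p.1 p.2).comap_le) hind.iIndep (h.preimage Prod.fst)

theorem measure_inter_of_disjoint (hX : ∀ n i, Measurable (X n i))
    (hind : iIndepFun (fun p : ℕ+ × Fin k => X p.1 p.2) P) {W W' : Set ℕ+} (h : Disjoint W W')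
    {A B : Set Ω} (hA : MeasurableSet[delaySigma X W] A) (hB : MeasurableSet[delaySigma X W'] B) :
    P (A ∩ B) = P A * P B :=
  (Indep_iff _ _ P).1 (indep_delaySigma hX hind h) A B hA hB

/-- Kolmogorov's 0-1 law for events determined by the delays at the vertices `n ≥ a`, for every
`a`. -/
theorem measure_zero_or_one_of_tail (hX : ∀ n i, Measurable (X n i))
    (hind : iIndepFun (fun p : ℕ+ × Fin k => X p.1 p.2) P) {A : Set Ω}
    (hA : ∀ a : ℕ+, MeasurableSet[delaySigma X (Set.Ici a)] A) : P A = 0 ∨ P A = 1 := by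
  let s : ℕ+ × Fin k → MeasurableSpace Ω := fun p =>
    MeasurableSpace.comap (X p.1 p.2) inferInstance
  refine measure_zero_or_one_of_measurableSet_limsup (s := s)
    (f := (atTop : Filter ℕ+).comap Prod.fst)
    (p := fun t => ∃ a, t ⊆ {p : ℕ+ × Fin k | p.1 ≤ a}) (ns := fun a => {p | p.1 ≤ a})
    (fun p => (hX p.1 p.2).comap_le) hind.iIndep ?_ ?_ (fun a => ⟨a, subset_rfl⟩)
    (fun p => ⟨p.1, le_refl p.1⟩) ?_
  · rintro t ⟨a, ha⟩
    refine ⟨Set.Ioi a, Ioi_mem_atTop a, fun p hp hpt => ?_⟩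
    exact not_le.2 (show a < p.1 from hp) (show p.1 ≤ a from ha hpt)
  · exact directed_of_isDirected_le fun a b hab p hp => le_trans hp hab
  · rw [((atTop_basis (α := ℕ+)).comap Prod.fst).limsup_eq_iInf_iSup]
    simp only [MeasurableSpace.measurableSet_iInf]
    intro a _
    exact hA a

end Delays

/-! ### The probability of regeneration -/

theorem measure_forall_lt_eq_pow {Ω ι : Type*} [MeasurableSpace Ω] [Fintype ι] {P : Measure Ω}
    {Y : ι → Ω → ℕ+} {Z : Ω → ℕ+} (hY : ∀ i, IdentDistrib (Y i) Z P P) (hind : iIndepFun Y P)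
    (t : ℕ) : P {ω | ∀ i, t < (Y i ω : ℕ)} = P {ω | t < (Z ω : ℕ)} ^ Fintype.card ι := by
  have hset : {ω | ∀ i, t < (Y i ω : ℕ)} = ⋂ i, Y i ⁻¹' {m : ℕ+ | t < (m : ℕ)} := by
    ext ω; simp
  rw [hset, hind.meas_iInter fun i => ⟨_, MeasurableSet.of_discrete, rfl⟩]
  rw [Finset.prod_congr rfl fun i _ =>
    (hY i).measure_mem_eq (MeasurableSet.of_discrete (s := {m : ℕ+ | t < (m : ℕ)}))]
  simp

theorem exists_mem_closure_eq_add {S : Set ℕ} {j : ℕ} (hj : j ∈ AddSubmonoid.closure S)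
    (h0 : j ≠ 0) : ∃ s ∈ S, ∃ r ∈ AddSubmonoid.closure S, j = r + s := by
  induction hj using AddSubmonoid.closure_induction_right with
  | zero => exact absurd rfl h0
  | add_right x hx y hy _ => exact ⟨y, hy, x, hx, rfl⟩

section

variable {Ω : Type*} {k : ℕ} {X : ℕ+ → Fin k → Ω → ℕ+}

theorem measurableSet_isRegeneration (S : Set ℕ) (v : ℕ+) :
    MeasurableSet[delaySigma X (Set.Ioi v)]
      {ω | IsRegeneration S (fun n i => X n i ω) v} := by
  have hset : {ω | IsRegeneration S (fun n i => X n i ω) v} =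
      ⋂ (j : ℕ+) (_ : (j : ℕ) ∈ S), ⋃ i, {ω | ∃ r ∈ S, (j : ℕ) = r + X (v + j) i ω} := by
    ext ω; simp [IsRegeneration]
  rw [hset]
  exact MeasurableSet.iInter fun j => MeasurableSet.iInter fun _ => MeasurableSet.iUnion fun i =>
    measurableSet_delaySigma (show v < v + j from PNat.lt_add_right v j) i
      fun m => ∃ r ∈ S, (j : ℕ) = r + m

variable [MeasurableSpace Ω] {P : Measure Ω} {Z : Ω → ℕ+}

/-- Regeneration has probability bounded below uniformly in the vertex. Beyond a large distance
`N + L`, it suffices that the shortest delay at distance `j` is at most `j - N`; as the expected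
minimum of the delays is finite, a union bound makes this likely. The finitely many nearer vertices
use only their first delay, which takes a prescribed value of the support with positive
probability, and the two constraints involve disjoint sets of vertices. -/
theorem exists_pos_le_measure_isRegeneration [IsProbabilityMeasure P] (hk : 0 < k)
    (hX : ∀ n i, Measurable (X n i))
    (hind : iIndepFun (fun p : ℕ+ × Fin k => X p.1 p.2) P)
    (hlaw : ∀ n i, IdentDistrib (X n i) Z P P) {N : ℕ}
    (hN : ∀ m ≥ N, m ∈ AddSubmonoid.closure (lawSupport P Z))
    (hsum : ∑' t : ℕ, P {ω | t < (Z ω : ℕ)} ^ k ≠ ∞) :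
    ∃ c : ℝ≥0∞, 0 < c ∧ ∀ v, c ≤ P {ω | IsRegeneration
      (AddSubmonoid.closure (lawSupport P Z) : Set ℕ) (fun n i => X n i ω) v} := by
  classical
  set S : AddSubmonoid ℕ := AddSubmonoid.closure (lawSupport P Z)
  let i₀ : Fin k := ⟨0, hk⟩
  -- The value prescribed for the first delay at distance `j ∈ S` above the regeneration vertex.
  have hd : ∀ j : ℕ+, (j : ℕ) ∈ S → ∃ d : ℕ+, 0 < P (Z ⁻¹' {d}) ∧ ∃ r ∈ S, (j : ℕ) = r + d := by
    intro j hj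
    obtain ⟨s, hs, r, hr, hjr⟩ := exists_mem_closure_eq_add hj j.ne_zero
    obtain ⟨ω, hω⟩ := nonempty_of_measure_ne_zero (ne_of_gt hs)
    have hω : (Z ω : ℕ) = s := hω
    refine ⟨Z ω, ?_, r, hr, by rw [hjr, hω]⟩
    have : Z ⁻¹' {Z ω} = {ω | (Z ω : ℕ) = s} := by
      ext ω'
      simp only [Set.mem_preimage, Set.mem_singleton_iff, Set.mem_ofPred_eq, ← hω, PNat.coe_inj]
    rw [this]
    exact hs
  choose! d hdpos hdS using hd
  obtain ⟨L, hL⟩ : ∃ L : ℕ, ∑' t : ℕ, P {ω | L + t < (Z ω : ℕ)} ^ k ≤ 1 / 2 := by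
    have := (ENNReal.tendsto_sum_nat_add (fun t : ℕ => P {ω | t < (Z ω : ℕ)} ^ k) hsum)
    obtain ⟨L, hL⟩ := (this.eventually_le_const (show (0 : ℝ≥0∞) < 1 / 2 by simp)).exists
    exact ⟨L, by simpa only [add_comm] using hL⟩
  -- Vertices at distance at most `B` are steered by their first delay (event `H`), the others by
  -- their shortest delay (event `A`).
  set B := N + L with hB
  let J : Finset ℕ+ := (Finset.Icc 1 (B.succPNat)).filter fun j => (j : ℕ) ≤ B ∧ (j : ℕ) ∈ S
  have hJ : ∀ j ∈ J, (j : ℕ) ≤ B ∧ (j : ℕ) ∈ S := fun j hj => (Finset.mem_filter.1 hj).2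
  refine ⟨(∏ j ∈ J, P (Z ⁻¹' {d j})) * (1 / 2), ?_, fun v => ?_⟩
  · refine ENNReal.mul_pos ?_ (by simp)
    exact Finset.prod_ne_zero_iff.2 fun j hj => (hdpos j (hJ j hj).2).ne'
  let H : Set Ω := ⋂ j ∈ J, X (v + j) i₀ ⁻¹' {d j}
  let A : Set Ω := ⋂ t : ℕ, ⋃ i, {ω | (X (v + (B + t).succPNat) i ω : ℕ) ≤ L + t}
  have hHP : P H = ∏ j ∈ J, P (Z ⁻¹' {d j}) := by
    have hinj : Function.Injective fun j : ℕ+ => (v + j, i₀) := fun a b hab =>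
      add_left_cancel (Prod.ext_iff.1 hab).1
    have := (hind.precomp hinj).meas_biInter (S := J) (s := fun j => X (v + j) i₀ ⁻¹' {d j})
      fun j _ => ⟨{d j}, MeasurableSet.of_discrete, rfl⟩
    rw [this]
    exact Finset.prod_congr rfl fun j _ => (hlaw _ _).measure_mem_eq MeasurableSet.of_discrete
  have hHm : MeasurableSet[delaySigma X {n | (n : ℕ) ≤ v + B}] H := by
    refine Finset.measurableSet_biInter _ fun j hj => ?_
    refine measurableSet_delaySigma (X := X) ?_ i₀ (fun m => m = d j)
    have := (hJ j hj).1
    simpa using this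
  have hAm : MeasurableSet[delaySigma X {n | (v : ℕ) + B < n}] A := by
    refine MeasurableSet.iInter fun t => MeasurableSet.iUnion fun i => ?_
    refine measurableSet_delaySigma (X := X) ?_ i (fun m => (m : ℕ) ≤ L + t)
    simp only [Set.mem_ofPred_eq, PNat.add_coe, Nat.succPNat_coe]
    omega
  have hdisj : Disjoint {n : ℕ+ | (n : ℕ) ≤ v + B} {n : ℕ+ | (v : ℕ) + B < n} :=
    Set.disjoint_left.2 fun n h1 h2 => absurd (show (n : ℕ) ≤ v + B from h1) (not_le.2 h2)
  have hAc : P Aᶜ ≤ 1 / 2 := by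
    have hsub : Aᶜ = ⋃ t : ℕ, {ω | ∀ i, L + t < (X (v + (B + t).succPNat) i ω : ℕ)} := by
      ext ω; simp [A]
    rw [hsub]
    refine (measure_iUnion_le _).trans (le_trans (le_of_eq ?_) hL)
    refine tsum_congr fun t => ?_
    have hinj : Function.Injective fun i : Fin k => (v + (B + t).succPNat, i) := fun a b hab =>
      (Prod.ext_iff.1 hab).2
    simpa using measure_forall_lt_eq_pow (fun i => hlaw (v + (B + t).succPNat) i)
      (hind.precomp (g := fun i : Fin k => (v + (B + t).succPNat, i)) hinj) (L + t)
  have hA : 1 / 2 ≤ P A := by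
    have h1 := prob_add_prob_compl (μ := P) (delaySigma_le hX _ _ hAm)
    by_contra! hlt
    have h2 := ENNReal.add_lt_add_of_lt_of_le (measure_ne_top _ _) hlt hAc
    rw [h1, ENNReal.add_halves] at h2
    exact lt_irrefl _ h2
  calc (∏ j ∈ J, P (Z ⁻¹' {d j})) * (1 / 2) ≤ P H * P A := by rw [hHP]; gcongr
    _ = P (H ∩ A) := (measure_inter_of_disjoint hX hind hdisj hHm hAm).symm
    _ ≤ _ := measure_mono ?_
  rintro ω ⟨hωH, hωA⟩ j hj
  by_cases hjB : (j : ℕ) ≤ B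
  · have hjJ : j ∈ J := Finset.mem_filter.2
      ⟨Finset.mem_Icc.2 ⟨one_le, PNat.coe_le_coe _ _ |>.1 (by simp; omega)⟩, hjB, hj⟩
    have hXd : X (v + j) i₀ ω = d j := Set.mem_iInter₂.1 hωH j hjJ
    obtain ⟨r, hr, hjr⟩ := hdS j hj
    exact ⟨i₀, r, hr, show (j : ℕ) = r + X (v + j) i₀ ω by rw [hXd, hjr]⟩
  · obtain ⟨t, ht⟩ := Nat.exists_eq_add_of_lt (not_le.1 hjB)
    have hjt : j = (B + t).succPNat := PNat.eq (by simp; omega)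
    obtain ⟨i, hi⟩ := Set.mem_iUnion.1 (Set.mem_iInter.1 hωA t)
    have hi : (X (v + j) i ω : ℕ) ≤ L + t := by rw [hjt]; exact hi
    exact ⟨i, (j : ℕ) - X (v + j) i ω, hN _ (by omega),
      show (j : ℕ) = (j : ℕ) - X (v + j) i ω + X (v + j) i ω by omega⟩

/-! ### Regeneration vertices with long delays -/

/-- A Borel–Cantelli lemma for events `R v ∩ D v` in which `R v` looks only at vertices above `v`
and `D v` only at `v`: the sum of the `P (D v)` diverges and `P (R v)` is bounded below, so the
second-moment bound gives infinitely many occurrences with positive probability, and the 0-1 law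
upgrades this to probability one. No independence between the `R v` is needed, because
`R u ∩ D u ∩ (R v ∩ D v)` is contained in `D u ∩ D v`. -/
theorem ae_exists_mem_inter [IsProbabilityMeasure P] (hX : ∀ n i, Measurable (X n i))
    (hind : iIndepFun (fun p : ℕ+ × Fin k => X p.1 p.2) P) {R D : ℕ+ → Set Ω}
    (hRm : ∀ v, MeasurableSet[delaySigma X (Set.Ioi v)] (R v))
    (hDm : ∀ v, MeasurableSet[delaySigma X {v}] (D v)) {c : ℝ≥0∞} (hc : 0 < c)
    (hR : ∀ v, c ≤ P (R v)) (hD : ∑' n : ℕ, P (D n.succPNat) = ∞) :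
    ∀ᵐ ω ∂P, ∃ v, ω ∈ R v ∩ D v := by
  have hEm : ∀ v, MeasurableSet[delaySigma X (Set.Ici v)] (R v ∩ D v) := fun v =>
    (delaySigma_mono Set.Ioi_subset_Ici_self _ (hRm v)).inter
      (delaySigma_mono (Set.singleton_subset_iff.2 Set.self_mem_Ici) _ (hDm v))
  have hE : ∀ v, MeasurableSet (R v ∩ D v) := fun v => delaySigma_le hX _ _ (hEm v)
  have hPE : ∀ v, P.real (R v ∩ D v) = P.real (R v) * P.real (D v) := fun v => by
    simp only [measureReal_def]
    rw [measure_inter_of_disjoint hX hind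
      (Set.disjoint_singleton_right.2 (lt_irrefl v)) (hRm v) (hDm v), ENNReal.toReal_mul]
  have hc1 : c ≠ ∞ := (((hR 1).trans prob_le_one).trans_lt ENNReal.one_lt_top).ne
  have hc0 : 0 < c.toReal := ENNReal.toReal_pos hc.ne' hc1
  -- `⋂ a, U a` is the event that `R v ∩ D v` occurs for infinitely many `v`.
  let U : ℕ → Set Ω := fun a => ⋃ n ≥ a, R (Nat.succPNat n) ∩ D (Nat.succPNat n)
  have hUm : ∀ a, MeasurableSet[delaySigma X (Set.Ici a.succPNat)] (U a) := fun a =>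
    MeasurableSet.iUnion fun n => MeasurableSet.iUnion fun hn =>
      delaySigma_mono (Set.Ici_subset_Ici.2 (Nat.succPNat_mono hn)) _ (hEm _)
  have hUanti : Antitone U := fun a b hab =>
    Set.biUnion_subset_biUnion_left fun n (hn : b ≤ n) => hab.trans hn
  have hU : ∀ a, ENNReal.ofReal (c.toReal ^ 2 / 2) ≤ P (U a) := by
    intro a
    have htail : ∑' t : ℕ, P (D (t + a).succPNat) = ∞ := by
      have hsplit := Summable.sum_add_tsum_nat_add' (f := fun n : ℕ => P (D n.succPNat)) (k := a)
        ENNReal.summable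
      rw [hD, ENNReal.add_eq_top] at hsplit
      exact hsplit.resolve_left (ENNReal.sum_ne_top.2 fun _ _ => measure_ne_top _ _)
    obtain ⟨F, hF⟩ : ∃ F : Finset ℕ, 1 ≤ ∑ t ∈ F, P.real (D (t + a).succPNat) := by
      rw [ENNReal.tsum_eq_iSup_sum] at htail
      obtain ⟨F, hF⟩ := lt_iSup_iff.1 (htail ▸ ENNReal.one_lt_top)
      refine ⟨F, ?_⟩
      simp only [measureReal_def]
      rw [← ENNReal.toReal_sum fun _ _ => measure_ne_top _ _, ← ENNReal.toReal_one]
      exact ENNReal.toReal_mono (ENNReal.sum_ne_top.2 fun _ _ => measure_ne_top _ _) hF.le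
    have hKS := sq_div_two_le_measureReal_biUnion (P := P)
      (E := fun t : ℕ => R (t + a).succPNat ∩ D (t + a).succPNat) (fun t => hE _)
      (p := fun t => P.real (D (t + a).succPNat)) hc0.le F ?_
      (fun t => measureReal_mono Set.inter_subset_right) ?_ hF
    · refine (ENNReal.ofReal_le_of_le_toReal hKS).trans (measure_mono ?_)
      refine Set.iUnion₂_subset fun t _ => ?_
      exact Set.subset_biUnion_of_mem
        (u := fun n : ℕ => R (Nat.succPNat n) ∩ D (Nat.succPNat n)) (show t + a ≥ a by omega)
    · intro t
      rw [hPE]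
      gcongr
      exact ENNReal.toReal_mono (measure_ne_top _ _) (hR _)
    · intro t u htu
      have hne : (t + a).succPNat ≠ (u + a).succPNat := fun h =>
        htu (add_right_cancel (Nat.succPNat_injective h))
      calc _ ≤ P.real (D (t + a).succPNat ∩ D (u + a).succPNat) :=
            measureReal_mono (Set.inter_subset_inter Set.inter_subset_right Set.inter_subset_right)
        _ = _ := by
            simp only [measureReal_def]
            rw [measure_inter_of_disjoint hX hind
              (Set.disjoint_singleton.2 hne) (hDm _) (hDm _), ENNReal.toReal_mul]
  have hlim : ENNReal.ofReal (c.toReal ^ 2 / 2) ≤ P (⋂ a, U a) :=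
    ge_of_tendsto' (tendsto_measure_iInter_atTop
      (fun a => (delaySigma_le hX _ _ (hUm a)).nullMeasurableSet) hUanti
      ⟨0, measure_ne_top _ _⟩) hU
  have hone : P (⋂ a, U a) = 1 := by
    refine (measure_zero_or_one_of_tail hX hind fun b => ?_).resolve_left
      (ne_of_gt (lt_of_lt_of_le (ENNReal.ofReal_pos.2 (by positivity)) hlim))
    have hshift : ⋂ a, U a = ⋂ a : ℕ, U (a + b) :=
      Set.Subset.antisymm (Set.subset_iInter fun a => Set.iInter_subset _ _)
        (Set.subset_iInter fun a => (Set.iInter_subset _ a).trans (hUanti (by omega)))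
    rw [hshift]
    refine MeasurableSet.iInter fun a => delaySigma_mono ?_ _ (hUm _)
    refine Set.Ici_subset_Ici.2 ((PNat.coe_le_coe _ _).1 ?_)
    simp only [Nat.succPNat_coe]
    omega
  have hmeas : MeasurableSet (⋂ a, U a) :=
    MeasurableSet.iInter fun a => delaySigma_le hX _ _ (hUm a)
  filter_upwards [mem_ae_iff.2 ((prob_compl_eq_zero_iff hmeas).2 hone)] with ω hω
  obtain ⟨n, -, hn⟩ := Set.mem_iUnion₂.1 (Set.mem_iInter.1 hω 0)
  exact ⟨n.succPNat, hn⟩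

theorem ae_exists_isRegeneration_and_le [IsProbabilityMeasure P] (hk : 0 < k)
    (hX : ∀ n i, Measurable (X n i))
    (hind : iIndepFun (fun p : ℕ+ × Fin k => X p.1 p.2) P)
    (hlaw : ∀ n i, IdentDistrib (X n i) Z P P) (S : Set ℕ) {c : ℝ≥0∞} (hc : 0 < c)
    (hreg : ∀ v, c ≤ P {ω | IsRegeneration S (fun n i => X n i ω) v})
    (hsum : ∑' t : ℕ, P {ω | t < (Z ω : ℕ)} = ∞) (K : ℕ) :
    ∀ᵐ ω ∂P, ∃ v, IsRegeneration S (fun n i => X n i ω) v ∧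
      ∃ i, (v : ℕ) + K ≤ X v i ω := by
  let i₀ : Fin k := ⟨0, hk⟩
  have hlong : ∀ n : ℕ, P {ω | (n.succPNat : ℕ) + K ≤ X n.succPNat i₀ ω} =
      P {ω | n + K < (Z ω : ℕ)} := fun n => by
    have hset : {ω | (n.succPNat : ℕ) + K ≤ X n.succPNat i₀ ω} =
        X n.succPNat i₀ ⁻¹' {m : ℕ+ | n + K < (m : ℕ)} := by
      ext ω
      simp only [Set.mem_ofPred_eq, Set.mem_preimage, Nat.succPNat_coe]
      omega
    rw [hset]
    exact (hlaw _ _).measure_mem_eq MeasurableSet.of_discrete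
  have hdiv : ∑' n : ℕ, P {ω | (n.succPNat : ℕ) + K ≤ X n.succPNat i₀ ω} = ∞ := by
    have hsplit := Summable.sum_add_tsum_nat_add' (f := fun t : ℕ => P {ω | t < (Z ω : ℕ)})
      (k := K) ENNReal.summable
    rw [hsum, ENNReal.add_eq_top] at hsplit
    rw [tsum_congr hlong]
    exact hsplit.resolve_left (ENNReal.sum_ne_top.2 fun _ _ => measure_ne_top _ _)
  have hDm : ∀ v : ℕ+, MeasurableSet[delaySigma X {v}] {ω | (v : ℕ) + K ≤ X v i₀ ω} := fun v =>
    measurableSet_delaySigma (Set.mem_singleton v) i₀ fun m => (v : ℕ) + K ≤ m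
  filter_upwards [ae_exists_mem_inter hX hind (fun v => measurableSet_isRegeneration S v) hDm
    hc hreg hdiv] with ω ⟨v, hvR, hvD⟩
  exact ⟨v, hvR, i₀, hvD⟩

end

end KChoice

theorem mainTheorem8 {Ω : Type*} [MeasurableSpace Ω] (P : Measure Ω) [IsProbabilityMeasure P]
    (k : ℕ) (hk : 2 ≤ k)
    -- the generic delay `Z`, and `k` independent copies of it
    (Z : Ω → ℕ+) (Zcopy : Fin k → Ω → ℕ+)
    (hcopy : ∀ i, IdentDistrib (Zcopy i) Z P P)
    (hcopy_indep : iIndepFun Zcopy P)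
    -- the delays `Z_n^{(i)}` of the `k`-choice model, i.i.d. with the law of `Z`
    (Zs : ℕ+ → Fin k → Ω → ℕ+)
    (hZs : ∀ n i, IdentDistrib (Zs n i) Z P P)
    (hZs_indep : iIndepFun (fun p : ℕ+ × Fin k => Zs p.1 p.2) P)
    (haper : KChoice.Aperiodic P Z)
    (hmean : ∫⁻ ω, ((Z ω : ℕ) : ℝ≥0∞) ∂P = ∞)
    (hmin : ∫⁻ ω, (⨅ i, ((Zcopy i ω : ℕ) : ℝ≥0∞)) ∂P < ∞) :
    ∀ᵐ ω ∂P, Tendsto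
      (fun n : ℕ => KChoice.numLeaves (fun m i => Zs m i ω) (n : ℤ)) atTop atTop := by
  have hk0 : 0 < k := by omega
  -- `IdentDistrib` only gives a.e. measurability; pass to measurable versions of the delays.
  let X : ℕ+ → Fin k → Ω → ℕ+ := fun n i => (hZs n i).aemeasurable_fst.mk (Zs n i)
  have hX : ∀ n i, Measurable (X n i) := fun n i => (hZs n i).aemeasurable_fst.measurable_mk
  have hXZ : ∀ n i, Zs n i =ᵐ[P] X n i := fun n i => (hZs n i).aemeasurable_fst.ae_eq_mk
  have hind : iIndepFun (fun p : ℕ+ × Fin k => X p.1 p.2) P :=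
    hZs_indep.congr fun p => hXZ p.1 p.2
  have hlaw : ∀ n i, IdentDistrib (X n i) Z P P := fun n i =>
    (IdentDistrib.of_ae_eq (hZs n i).aemeasurable_fst (hXZ n i)).symm.trans (hZs n i)
  have hsum : ∑' t : ℕ, P {ω | t < (Z ω : ℕ)} = ∞ := by
    rw [← lintegral_pnat_eq_tsum (hcopy ⟨0, hk0⟩).aemeasurable_snd, hmean]
  have hsum_pow : ∑' t : ℕ, P {ω | t < (Z ω : ℕ)} ^ k ≠ ∞ := by
    refine ((le_of_eq ?_).trans_lt ((tsum_measure_lt_le_lintegral_iInf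
      fun i => (hcopy i).aemeasurable_fst).trans_lt hmin)).ne
    exact tsum_congr fun t => by
      rw [KChoice.measure_forall_lt_eq_pow hcopy hcopy_indep, Fintype.card_fin]
  obtain ⟨N, hN⟩ := Nat.exists_mem_closure_of_ge (KChoice.lawSupport P Z)
  have hN : ∀ m ≥ N, m ∈ AddSubmonoid.closure (KChoice.lawSupport P Z) := fun m hm =>
    hN m hm (by rw [show Nat.setGcd (KChoice.lawSupport P Z) = 1 from haper]; exact one_dvd m)
  obtain ⟨c, hc, hreg⟩ :=
    KChoice.exists_pos_le_measure_isRegeneration hk0 hX hind hlaw hN hsum_pow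
  have hlong := ae_all_iff.2 fun K =>
    KChoice.ae_exists_isRegeneration_and_le hk0 hX hind hlaw _ hc hreg hsum K
  filter_upwards [hlong, ae_all_iff.2 fun n => ae_all_iff.2 fun i => hXZ n i] with ω hω hωX
  simp only [hωX]
  exact KChoice.tendsto_numLeaves _ hN hω
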